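/- Let $\ell_1$ be the complex Banach space of absolutely summable sequences. A continuous linear operator $S$ on a topological vector space $Y$ is called hypercyclic if there is $y\in Y$ such that for every nonempty open set $U\subseteq Y$ there is $n\ge 0$ with $S^n y\in U$. It is called weakly mixing if $S\oplus S$ is hypercyclic on $Y\oplus Y$. It satisfies the hypercyclicity criterion if there are dense sets $D_1,D_2\subseteq Y$, a strictly increasing sequence $(n_k)$ of natural numbers and maps $S_k:D_2\to Y$ (not necessarily linear or continuous) such that $S^{n_k}x\to 0$ for every $x\in D_1$, and $S_k y\to 0$ and $S^{n_k}S_k y\to y$ for every $y\in D_2$. Theorem. There exists a continuous linear operator $T:\ell_1\to\ell_1$ such that $T$ is not weakly mixing, and hence does not satisfy the hypercyclicity criterion, but the operator $T\oplus T^2\oplus\cdots\oplus T^n$ is hypercyclic on the direct sum of $n$ copies of $\ell_1$ for every $n\ge 1$. In particular, hypercyclicity of $T\oplus T^2\oplus\cdots\oplus T^n$ for every $n\geq 1$ does not imply that $T$ satisfies the hypercyclicity criterion. -/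

import Mathlib

open Filter Topology

section Hypercyclicity

variable {𝕜 E : Type*} [NontriviallyNormedField 𝕜] [AddCommGroup E] [Module 𝕜 E]
  [TopologicalSpace E]

/-- The set of hitting times `N_T(x, U) = {n : T^n x ∈ U}`. -/
def hittingTimes (T : E →L[𝕜] E) (x : E) (U : Set E) : Set ℕ :=
  {n : ℕ | (T ^ n) x ∈ U}

/-- `T` is hypercyclic: some vector has an orbit that meets every nonempty open set. -/
def IsHypercyclic (T : E →L[𝕜] E) : Prop :=
  ∃ x : E, ∀ U : Set E, IsOpen U → U.Nonempty → (hittingTimes T x U).Nonempty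

/-- `T` is weakly mixing: `T ⊕ T` is hypercyclic on `E ⊕ E`. -/
def IsWeaklyMixing (T : E →L[𝕜] E) : Prop :=
  IsHypercyclic (T.prodMap T)

/-- The direct sum `T ⊕ T² ⊕ ⋯ ⊕ Tⁿ` on `E ⊕ ⋯ ⊕ E` (`n` summands): the summand with
index `i : Fin n` carries the power `T ^ (i + 1)`. -/
def directSumPowers (T : E →L[𝕜] E) (n : ℕ) : (Fin n → E) →L[𝕜] (Fin n → E) :=
  ContinuousLinearMap.pi fun i : Fin n =>
    (T ^ ((i : ℕ) + 1)).comp (ContinuousLinearMap.proj (R := 𝕜) (φ := fun _ : Fin n => E) i)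

/-- The hypercyclicity criterion. The maps `S k : D₂ → E` are arbitrary (neither linear nor
continuous). -/
def SatisfiesHypercyclicityCriterion (T : E →L[𝕜] E) : Prop :=
  ∃ D₁ D₂ : Set E, Dense D₁ ∧ Dense D₂ ∧
    ∃ (n : ℕ → ℕ) (S : ℕ → D₂ → E), StrictMono n ∧
      (∀ x ∈ D₁, Tendsto (fun k => (T ^ n k) x) atTop (𝓝 0)) ∧
      (∀ y : D₂, Tendsto (fun k => S k y) atTop (𝓝 0)) ∧
      (∀ y : D₂, Tendsto (fun k => (T ^ n k) (S k y)) atTop (𝓝 (y : E)))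

end Hypercyclicity

/-! ### Symmetric forms as an obstruction to weak mixing -/

section InvariantForm

variable {E : Type*} [NormedAddCommGroup E] [NormedSpace ℂ E]

/-! The operator is multiplication by X on a free ℂ[X]-module with generators g₀, g₁, …, completed
to ℓ¹. The obstruction is a nonzero bounded bilinear form with ⟨Tx, y⟩ = ⟨x, Ty⟩: the functional (u,
v) ↦ ⟨u, y⟩ - ⟨x, v⟩ vanishes along the orbit of (x, y) under T ⊕ T, so a dense orbit would force
the form to be zero.

Hypercyclicity is built into the norm, the ℓ¹ norm of a basis in which gₙ (n ≥ 1) and rₙ = X^bₙ gₙ -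
Cₙ are unit vectors. Taking Cₙ = η⁻¹(Qₙ - X^bₙ Pₙ) gives X^bₙ (Pₙ + η gₙ) = Qₙ + η rₙ, so a vector
η-close to Pₙ is sent η-close to Qₙ. Generators come in blocks of length 2^s with exponents m, 2m,
…, 2^s m, so a single m serves T, T², …, Tⁿ at once. These exponents are distinct and widely spaced,
which is what allows the form to stay bounded.

The form makes rₙ (n ≥ 1) orthogonal to all X^p gₗ with l ≤ n, and ⟨gₙ, X^p gₗ⟩ = 0 for p < bₙ. Its
remaining values have bounds independent of the exponents, so the geometric weights of the basis
beat them when the gaps are large (`norm_form_basisVec_le`). Weights increasing with n keep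
multiplication by X bounded (`norm_toSpace_shift_basisVec_le`). -/

theorem form_pow_apply {T : E →L[ℂ] E} {B : E →L[ℂ] E →L[ℂ] ℂ}
    (hT : ∀ x y, B (T x) y = B x (T y)) (n : ℕ) (x y : E) :
    B ((T ^ n) x) y = B x ((T ^ n) y) := by
  induction n generalizing x with
  | zero => simp
  | succ n ih =>
    rw [pow_succ, mul_apply_eq_comp, ih, hT, ← mul_apply_eq_comp,
      ← pow_succ', pow_succ]

/-- An operator that is symmetric for a nonzero bounded bilinear form is not weakly mixing. -/
theorem not_isWeaklyMixing_of_form {T : E →L[ℂ] E} {B : E →L[ℂ] E →L[ℂ] ℂ}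
    (hT : ∀ x y, B (T x) y = B x (T y)) (hB : B ≠ 0) : ¬ IsWeaklyMixing T := by
  rintro ⟨⟨x, y⟩, hxy⟩
  have hpow : ∀ n : ℕ, ((T.prodMap T) ^ n) (x, y) = ((T ^ n) x, (T ^ n) y) := by
    intro n
    induction n with
    | zero => simp
    | succ n ih =>
      rw [pow_succ', mul_apply_eq_comp, ih]
      simp [pow_succ']
  have hx : B x = 0 := by
    ext z
    by_contra hz
    have hz' : 0 < ‖B x z‖ := norm_pos_iff.2 hz
    -- On the orbit of (x, y) the terms involving y cancel by symmetry, so f is constantly B x z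
    -- there, while f (0, z) = 0.
    let f : E × E → ℂ := fun p => B p.1 y + B x (z - p.2)
    have hf : Continuous f := by fun_prop
    obtain ⟨n, hn⟩ := hxy (f ⁻¹' Metric.ball 0 ‖B x z‖) (Metric.isOpen_ball.preimage hf)
      ⟨(0, z), by simpa [f] using hz⟩
    simp only [hittingTimes, Set.mem_ofPred_eq, hpow, Set.mem_preimage, f, form_pow_apply hT] at hn
    simp at hn
  have hpx : ∀ n : ℕ, B ((T ^ n) x) = 0 := by
    intro n
    ext z
    rw [form_pow_apply hT, hx]
    simp
  apply hB
  ext u v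
  by_contra huv
  have huv' : 0 < ‖B u v‖ := norm_pos_iff.2 huv
  -- Here f is constantly B u v on the orbit, while f (u, 0) = 0.
  let f : E × E → ℂ := fun p => B (u - p.1) v
  have hf : Continuous f := by fun_prop
  obtain ⟨n, hn⟩ := hxy (f ⁻¹' Metric.ball 0 ‖B u v‖) (Metric.isOpen_ball.preimage hf)
    ⟨(u, 0), by simpa [f] using huv⟩
  simp only [hittingTimes, Set.mem_ofPred_eq, hpow, Set.mem_preimage, f, map_sub, hpx,
    sub_zero] at hn
  simp at hn

/-- An operator that is symmetric for a nonzero bounded bilinear form does not satisfy the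
hypercyclicity criterion. -/
theorem not_satisfiesHypercyclicityCriterion_of_form {T : E →L[ℂ] E} {B : E →L[ℂ] E →L[ℂ] ℂ}
    (hT : ∀ x y, B (T x) y = B x (T y)) (hB : B ≠ 0) :
    ¬ SatisfiesHypercyclicityCriterion T := by
  rintro ⟨D₁, D₂, hD₁, hD₂, n, S, -, h₁, h₂, h₃⟩
  have key : ∀ x ∈ D₁, ∀ y ∈ D₂, B x y = 0 := by
    intro x hx y hy
    have hc : Continuous fun p : E × E => B p.1 p.2 := by fun_prop
    have l₁ : Tendsto (fun k => B x ((T ^ n k) (S k ⟨y, hy⟩))) atTop (𝓝 (B x y)) :=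
      ((B x).continuous.tendsto y).comp (h₃ ⟨y, hy⟩)
    -- The same scalars with the power moved to the left: both arguments now tend to 0.
    have l₂ : Tendsto (fun k => B ((T ^ n k) x) (S k ⟨y, hy⟩)) atTop (𝓝 (B 0 0)) :=
      (hc.tendsto (0, 0)).comp ((h₁ x hx).prodMk_nhds (h₂ ⟨y, hy⟩))
    simp only [form_pow_apply hT] at l₂
    rw [tendsto_nhds_unique l₁ l₂]
    simp
  have key₂ : ∀ x ∈ D₁, B x = 0 := fun x hx => by
    have : (⇑(B x) : E → ℂ) = ⇑(0 : E →L[ℂ] ℂ) :=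
      Continuous.ext_on hD₂ (B x).continuous (0 : E →L[ℂ] ℂ).continuous fun y hy => by
        simpa using key x hx y hy
    exact DFunLike.coe_injective this
  apply hB
  apply DFunLike.coe_injective
  exact Continuous.ext_on hD₁ B.continuous (0 : E →L[ℂ] E →L[ℂ] ℂ).continuous fun x hx => by
    simpa using key₂ x hx

end InvariantForm

/-! ### Transitivity for direct sums of powers -/

section Transitivity

/-- Birkhoff's transitivity theorem. -/
theorem isHypercyclic_of_transitive {E : Type*} [NormedAddCommGroup E] [NormedSpace ℂ E]
    [CompleteSpace E] [SecondCountableTopology E] (S : E →L[ℂ] E)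
    (h : ∀ U V : Set E, IsOpen U → IsOpen V → U.Nonempty → V.Nonempty →
      ∃ m : ℕ, ∃ x ∈ U, (S ^ m) x ∈ V) : IsHypercyclic S := by
  let W : TopologicalSpace.countableBasis E → Set E := fun V => ⋃ m : ℕ, (S ^ m) ⁻¹' V.1
  have hVo : ∀ V : TopologicalSpace.countableBasis E, IsOpen V.1 := fun V =>
    (TopologicalSpace.isBasis_countableBasis E).isOpen V.2
  have hd : Dense (⋂ V, W V) := by
    refine dense_iInter_of_isOpen (fun V => isOpen_iUnion fun m =>
      (hVo V).preimage (S ^ m).continuous) fun V => ?_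
    rw [dense_iff_inter_open]
    intro U hU hUn
    obtain ⟨m, x, hx, hm⟩ := h U V.1 hU (hVo V) hUn
      (TopologicalSpace.nonempty_of_mem_countableBasis V.2)
    exact ⟨x, hx, Set.mem_iUnion.2 ⟨m, hm⟩⟩
  obtain ⟨x, hx⟩ := hd.nonempty
  refine ⟨x, fun U hU ⟨u, hu⟩ => ?_⟩
  obtain ⟨V, hV, -, hVU⟩ :=
    (TopologicalSpace.isBasis_countableBasis E).exists_subset_of_mem_open hu hU
  obtain ⟨m, hm⟩ := Set.mem_iUnion.1 (Set.mem_iInter.1 hx ⟨V, hV⟩)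
  exact ⟨m, hVU hm⟩

theorem directSumPowers_pow_apply {E : Type*} [NormedAddCommGroup E] [NormedSpace ℂ E]
    (T : E →L[ℂ] E) (n m : ℕ) (x : Fin n → E) (i : Fin n) :
    (directSumPowers T n ^ m) x i = (T ^ (((i : ℕ) + 1) * m)) (x i) := by
  induction m generalizing x with
  | zero => simp
  | succ m ih =>
    rw [pow_succ, mul_apply_eq_comp, ih, mul_add, mul_one, pow_add,
      mul_apply_eq_comp]
    rfl

/-- A sufficient condition, on a dense set, for `T ⊕ T² ⊕ ⋯ ⊕ Tⁿ` to be hypercyclic. -/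
theorem isHypercyclic_directSumPowers {E : Type*} [NormedAddCommGroup E] [NormedSpace ℂ E]
    [CompleteSpace E] [SecondCountableTopology E] (T : E →L[ℂ] E) (n : ℕ) {D : Set E}
    (hD : Dense D)
    (h : ∀ x y : Fin n → E, (∀ i, x i ∈ D) → (∀ i, y i ∈ D) → ∀ ε > 0, ∃ m : ℕ,
      ∃ z : Fin n → E, ∀ i : Fin n, ‖z i - x i‖ < ε ∧
        ‖(T ^ (((i : ℕ) + 1) * m)) (z i) - y i‖ < ε) :
    IsHypercyclic (directSumPowers T n) := by
  refine isHypercyclic_of_transitive _ fun U V hU hV hUn hVn => ?_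
  have hDn : Dense (Set.pi Set.univ fun _ : Fin n => D) := dense_pi _ fun _ _ => hD
  obtain ⟨x, hxU, hx⟩ := hDn.inter_open_nonempty U hU hUn
  obtain ⟨y, hyV, hy⟩ := hDn.inter_open_nonempty V hV hVn
  obtain ⟨ε, hε, hεU⟩ := Metric.isOpen_iff.1 hU x hxU
  obtain ⟨δ, hδ, hδV⟩ := Metric.isOpen_iff.1 hV y hyV
  obtain ⟨m, z, hz⟩ := h x y (fun i => hx i trivial) (fun i => hy i trivial) (min ε δ)
    (lt_min hε hδ)
  refine ⟨m, z, hεU ?_, hδV ?_⟩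
  · rw [Metric.mem_ball, dist_pi_lt_iff hε]
    exact fun i => by
      rw [dist_eq_norm]
      exact (hz i).1.trans_le (min_le_left _ _)
  · rw [Metric.mem_ball, dist_pi_lt_iff hδ]
    exact fun i => by
      rw [dist_eq_norm, directSumPowers_pow_apply]
      exact (hz i).2.trans_le (min_le_right _ _)

end Transitivity

/-! ### Operators on ℓ¹ and the free module -/

section SummableSequences

/-- The operator on `ℓ¹` with prescribed bounded values on the canonical basis. -/
theorem exists_clm_single_eq {Y : Type*} [NormedAddCommGroup Y] [NormedSpace ℂ Y]
    [CompleteSpace Y] (t : ℕ → Y) {K : ℝ} (ht : ∀ i, ‖t i‖ ≤ K) :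
    ∃ L : lp (fun _ : ℕ => ℂ) 1 →L[ℂ] Y, (∀ i, L (lp.single 1 i 1) = t i) ∧ ‖L‖ ≤ K := by
  have hs : ∀ f : lp (fun _ : ℕ => ℂ) 1, Summable fun i => ‖f i‖ := fun f => by
    simpa using (lp.hasSum_norm (by simp) f).summable
  have hb : ∀ (f : lp (fun _ : ℕ => ℂ) 1) i, ‖f i • t i‖ ≤ ‖f i‖ * K := fun f i => by
    rw [norm_smul]
    exact mul_le_mul_of_nonneg_left (ht i) (norm_nonneg _)
  have hst : ∀ f : lp (fun _ : ℕ => ℂ) 1, Summable fun i => f i • t i := fun f =>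
    Summable.of_norm_bounded ((hs f).mul_right K) (hb f)
  let L₀ : lp (fun _ : ℕ => ℂ) 1 →ₗ[ℂ] Y :=
    { toFun := fun f => ∑' i, f i • t i
      map_add' := fun f g => by
        rw [← (hst f).tsum_add (hst g)]
        exact tsum_congr fun i => by simp [add_smul]
      map_smul' := fun c f => by
        rw [RingHom.id_apply, ← (hst f).tsum_const_smul]
        exact tsum_congr fun i => by simp [mul_smul] }
  have hL : ∀ f, ‖L₀ f‖ ≤ K * ‖f‖ := fun f => by
    have h1 : HasSum (fun i => ‖f i‖) ‖f‖ := by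
      simpa using lp.hasSum_norm (p := 1) (by simp) f
    have := tsum_of_norm_bounded (h1.mul_right K) (hb f)
    rwa [mul_comm]
  refine ⟨L₀.mkContinuous K hL, fun i => ?_,
    L₀.mkContinuous_norm_le ((norm_nonneg _).trans (ht 0)) hL⟩
  · change ∑' j, (lp.single (E := fun _ : ℕ => ℂ) 1 i (1 : ℂ)) j • t j = t i
    rw [tsum_eq_single i fun j hj => by simp [lp.single_apply, hj]]
    simp

theorem norm_single_one (i : ℕ) : ‖lp.single (E := fun _ : ℕ => ℂ) 1 i (1 : ℂ)‖ = 1 := by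
  rw [lp.norm_single (by simp)]
  simp

/-- The embedding of the finitely supported double sequences into `ℓ¹`. -/
noncomputable def toEllOne : (ℕ × ℕ →₀ ℂ) →ₗ[ℂ] lp (fun _ : ℕ => ℂ) 1 :=
  Finsupp.linearCombination ℂ fun i => lp.single 1 (Nat.pair i.1 i.2) (1 : ℂ)

theorem toEllOne_single (i : ℕ × ℕ) (c : ℂ) :
    toEllOne (Finsupp.single i c) = c • lp.single 1 (Nat.pair i.1 i.2) (1 : ℂ) := by
  simp [toEllOne]

theorem norm_toEllOne_single (i : ℕ × ℕ) (c : ℂ) : ‖toEllOne (Finsupp.single i c)‖ = ‖c‖ := by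
  rw [toEllOne_single, norm_smul, norm_single_one, mul_one]

theorem denseRange_toEllOne : DenseRange toEllOne := by
  intro f
  have h := lp.hasSum_single (p := 1) (by simp) f
  refine mem_closure_of_tendsto h (Eventually.of_forall fun s => ?_)
  refine ⟨∑ i ∈ s, Finsupp.single (Nat.unpair i) (f i), ?_⟩
  rw [map_sum]
  refine Finset.sum_congr rfl fun i _ => ?_
  rw [toEllOne_single, Nat.pair_unpair, ← lp.single_smul]
  simp

theorem norm_map_le_of_single {Y : Type*} [NormedAddCommGroup Y] [NormedSpace ℂ Y]
    (f : (ℕ × ℕ →₀ ℂ) →ₗ[ℂ] Y) (y : ℕ × ℕ →₀ ℂ) {K : ℝ}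
    (h : ∀ i ∈ y.support, ‖f (Finsupp.single i 1)‖ ≤ K) :
    ‖f y‖ ≤ (∑ i ∈ y.support, ‖y i‖) * K := by
  have hy : f y = ∑ i ∈ y.support, y i • f (Finsupp.single i 1) := by
    conv_lhs => rw [← Finsupp.sum_single y]
    rw [Finsupp.sum, map_sum]
    refine Finset.sum_congr rfl fun i _ => ?_
    rw [← map_smul]
    simp
  rw [hy, Finset.sum_mul]
  refine (norm_sum_le _ _).trans (Finset.sum_le_sum fun i hi => ?_)
  rw [norm_smul]
  exact mul_le_mul_of_nonneg_left (h i hi) (norm_nonneg _)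

end SummableSequences

section Shift

/-- Multiplication by `X ^ u` on the free `ℂ[X]`-module with generators `g₀, g₁, …`, in the basis
`X ^ p • gₙ` indexed by the pairs `(n, p)`. -/
noncomputable def shift (u : ℕ) : (ℕ × ℕ →₀ ℂ) →ₗ[ℂ] (ℕ × ℕ →₀ ℂ) :=
  Finsupp.lmapDomain ℂ ℂ fun i => (i.1, i.2 + u)

theorem shift_single (u : ℕ) (i : ℕ × ℕ) (c : ℂ) :
    shift u (Finsupp.single i c) = Finsupp.single (i.1, i.2 + u) c := by
  simp [shift]

theorem shift_shift (u v : ℕ) (y : ℕ × ℕ →₀ ℂ) : shift u (shift v y) = shift (v + u) y := by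
  induction y using Finsupp.induction_linear with
  | zero => simp
  | add f g hf hg => simp only [map_add, hf, hg]
  | single i c => simp [shift_single, add_assoc]

theorem shift_zero (y : ℕ × ℕ →₀ ℂ) : shift 0 y = y := by
  exact Finsupp.mapDomain_id

theorem map_shift_eq_sum {Y : Type*} [AddCommGroup Y] [Module ℂ Y]
    (f : (ℕ × ℕ →₀ ℂ) →ₗ[ℂ] Y) (u : ℕ) (y : ℕ × ℕ →₀ ℂ) :
    f (shift u y) = y.sum fun i c => c • f (Finsupp.single (i.1, i.2 + u) 1) := by
  conv_lhs => rw [← Finsupp.sum_single y]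
  rw [Finsupp.sum, map_sum, map_sum, Finsupp.sum]
  refine Finset.sum_congr rfl fun i _ => ?_
  rw [shift_single, ← map_smul]
  simp

end Shift

/-! ### Weights and constants -/

section Rates

/-- The weights of the successive generators. -/
noncomputable def rate (n : ℕ) : ℝ := 2 - 1 / ((n : ℝ) + 2)

theorem one_lt_rate (n : ℕ) : 1 < rate n := by
  have : 1 / ((n : ℝ) + 2) < 1 := by
    rw [div_lt_one (by positivity)]
    linarith [n.cast_nonneg (α := ℝ)]
  unfold rate
  linarith

theorem rate_le_two (n : ℕ) : rate n ≤ 2 := by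
  have : 0 ≤ 1 / ((n : ℝ) + 2) := by positivity
  unfold rate
  linarith

/-- Strictness makes `rate (n + 1) / rate n` exceed 1, so a large exponent absorbs any constant
produced by earlier generators. -/
theorem rate_strictMono : StrictMono rate := by
  intro m n h
  have : 1 / ((n : ℝ) + 2) < 1 / ((m : ℝ) + 2) := by
    apply one_div_lt_one_div_of_lt (by positivity)
    have : (m : ℝ) < n := by exact_mod_cast h
    linarith
  unfold rate
  linarith

theorem rate_pos (n : ℕ) : 0 < rate n := zero_lt_one.trans (one_lt_rate n)

theorem rate_ne_zero (n : ℕ) : (rate n : ℂ) ≠ 0 := by exact_mod_cast (rate_pos n).ne'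

theorem norm_rate (n : ℕ) : ‖(rate n : ℂ)‖ = rate n := by
  rw [Complex.norm_real, Real.norm_of_nonneg (rate_pos n).le]

theorem one_le_rate_pow (n p : ℕ) : 1 ≤ rate n ^ p := one_le_pow₀ (one_lt_rate n).le

end Rates

section Bounds

/-- A bound for the values of the invariant form on the first `n + 1` generators. -/
noncomputable def formBound (A : ℕ → ℝ) : ℕ → ℝ
  | 0 => 1
  | n + 1 => formBound A n * A (n + 1) ^ 2

/-- The constant in the growth estimate for the orbit of the `n`-th generator. -/
noncomputable def growthBound (A : ℕ → ℝ) (d : ℕ → ℕ) : ℕ → ℝ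
  | 0 => 1
  | n + 1 => 1 + A (n + 1) * 2 ^ d (n + 1) * growthBound A d n

variable {A : ℕ → ℝ} {d : ℕ → ℕ}

theorem one_le_formBound (hA : ∀ n, 1 ≤ A n) (n : ℕ) : 1 ≤ formBound A n := by
  induction n with
  | zero => simp [formBound]
  | succ n ih =>
    rw [formBound]
    exact one_le_mul_of_one_le_of_one_le ih (one_le_pow₀ (hA _))

theorem one_le_growthBound (hA : ∀ n, 1 ≤ A n) (n : ℕ) : 1 ≤ growthBound A d n := by
  induction n with
  | zero => simp [growthBound]
  | succ n ih =>
    rw [growthBound]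
    have := hA (n + 1)
    have : 0 ≤ A (n + 1) * 2 ^ d (n + 1) * growthBound A d n := by positivity
    linarith

theorem growthBound_mono (hA : ∀ n, 1 ≤ A n) : Monotone (growthBound A d) :=
  monotone_nat_of_le_succ fun n => by
    rw [growthBound]
    have h0 := one_le_growthBound (d := d) hA n
    have h1 : 1 ≤ A (n + 1) * 2 ^ d (n + 1) :=
      one_le_mul_of_one_le_of_one_le (hA _) (one_le_pow₀ one_le_two)
    nlinarith

end Bounds

/-- Relations `X ^ bₙ • gₙ = Cₙ`, up to a basis vector, between the generators `gₙ` of a free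
`ℂ[X]`-module, with `Cₙ` in the span of the preceding generators, and with exponents `bₙ` so
sparse that the resulting operator and the resulting invariant form are bounded. -/
structure Tower where
  b : ℕ → ℕ
  C : ℕ → (ℕ × ℕ →₀ ℂ)
  A : ℕ → ℝ
  d : ℕ → ℕ
  one_le_A : ∀ n, 1 ≤ A n
  b_zero : b 0 = 0
  fst_lt : ∀ n, ∀ i ∈ (C n).support, i.1 < n
  snd_le : ∀ n, ∀ i ∈ (C n).support, i.2 ≤ b n + d n
  sum_norm_le : ∀ n, ∑ i ∈ (C n).support, ‖C n i‖ ≤ A n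
  sep : ∀ n, ∀ l < n, b l + d l < b n
  -- Used to bound the form on the normalized basis.
  form_le : ∀ n, ∀ l < n, 2 * A l * formBound A n ≤ rate 0 ^ (b n - b l - d l)
  -- Used to bound multiplication by X where it produces `C (n + 1)`.
  growth_le : ∀ n, growthBound A d (n + 1) * rate n ^ b (n + 1) ≤ rate (n + 1) ^ b (n + 1)

/-! ### The normalized basis and the invariant form -/

namespace Tower

variable (D : Tower)

/-- The relation vector `X ^ bₙ • gₙ - Cₙ`. -/
noncomputable def rel (n : ℕ) : ℕ × ℕ →₀ ℂ := Finsupp.single (n, D.b n) 1 - D.C n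

/-- The normalized basis of the module. -/
noncomputable def basisVec (i : ℕ × ℕ) : ℕ × ℕ →₀ ℂ :=
  if i.2 < D.b i.1 then ((rate i.1 : ℂ) ^ i.2)⁻¹ • Finsupp.single i 1
  else ((rate i.1 : ℂ) ^ (i.2 - D.b i.1))⁻¹ • shift (i.2 - D.b i.1) (D.rel i.1)

/-- The coordinates of `X ^ p • gₙ` in the normalized basis. -/
noncomputable def coordVec (i : ℕ × ℕ) : ℕ × ℕ →₀ ℂ :=
  if i.2 < D.b i.1 then Finsupp.single i ((rate i.1 : ℂ) ^ i.2)
  else Finsupp.single i ((rate i.1 : ℂ) ^ (i.2 - D.b i.1)) +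
    (D.C i.1).sum fun j c =>
      -- The test always succeeds by `fst_lt`; it serves the termination proof.
      if _h : j.1 < i.1 then c • coordVec (j.1, j.2 + (i.2 - D.b i.1)) else 0
termination_by i.1

/-- The map with `basisVec` as the images of the canonical basis. -/
noncomputable def fromCoord : (ℕ × ℕ →₀ ℂ) →ₗ[ℂ] (ℕ × ℕ →₀ ℂ) :=
  Finsupp.linearCombination ℂ D.basisVec

/-- The coordinate map of the normalized basis. -/
noncomputable def toCoord : (ℕ × ℕ →₀ ℂ) →ₗ[ℂ] (ℕ × ℕ →₀ ℂ) :=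
  Finsupp.linearCombination ℂ D.coordVec

/-- The values of the invariant form: `⟨X ^ p • gₙ, X ^ q • gₗ⟩ = formCoeff n l (p + q)`. -/
noncomputable def formCoeff (n l p : ℕ) : ℂ :=
  if max n l = 0 then if p = 0 then 1 else 0
  else if p < D.b (max n l) then 0
  -- Replacing X^b • g by C for the larger index is exactly orthogonality to the relation vector.
  else (D.C (max n l)).sum fun j c =>
    if _h : j.1 < max n l then c * formCoeff j.1 (min n l) (j.2 + (p - D.b (max n l))) else 0
termination_by n + l
decreasing_by omega

/-- The invariant form. -/
noncomputable def form : (ℕ × ℕ →₀ ℂ) →ₗ[ℂ] (ℕ × ℕ →₀ ℂ) →ₗ[ℂ] ℂ :=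
  Finsupp.linearCombination ℂ fun i =>
    Finsupp.linearCombination ℂ fun j => D.formCoeff i.1 j.1 (i.2 + j.2)

theorem fromCoord_single (i : ℕ × ℕ) (c : ℂ) :
    D.fromCoord (Finsupp.single i c) = c • D.basisVec i := by
  simp [fromCoord]

theorem toCoord_single (i : ℕ × ℕ) (c : ℂ) :
    D.toCoord (Finsupp.single i c) = c • D.coordVec i := by
  simp [toCoord]

theorem form_single (i j : ℕ × ℕ) (c e : ℂ) :
    D.form (Finsupp.single i c) (Finsupp.single j e) =
      c * (e * D.formCoeff i.1 j.1 (i.2 + j.2)) := by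
  simp [form]

theorem coordVec_of_lt {i : ℕ × ℕ} (h : i.2 < D.b i.1) :
    D.coordVec i = Finsupp.single i ((rate i.1 : ℂ) ^ i.2) := by
  rw [coordVec, if_pos h]

theorem coordVec_of_le {i : ℕ × ℕ} (h : D.b i.1 ≤ i.2) :
    D.coordVec i = Finsupp.single i ((rate i.1 : ℂ) ^ (i.2 - D.b i.1)) +
      D.toCoord (shift (i.2 - D.b i.1) (D.C i.1)) := by
  rw [coordVec, if_neg h.not_gt, map_shift_eq_sum]
  congr 1
  refine Finset.sum_congr rfl fun j hj => ?_
  beta_reduce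
  rw [dif_pos (D.fst_lt _ _ hj), toCoord_single, one_smul]

theorem toCoord_basisVec (i : ℕ × ℕ) : D.toCoord (D.basisVec i) = Finsupp.single i 1 := by
  unfold basisVec
  split_ifs with h
  · rw [map_smul, toCoord_single, one_smul, D.coordVec_of_lt h, Finsupp.smul_single, smul_eq_mul,
      inv_mul_cancel₀ (pow_ne_zero _ (rate_ne_zero _))]
  · have h' := not_lt.1 h
    rw [map_smul, rel, map_sub, map_sub, shift_single, toCoord_single, one_smul, coordVec_of_le]
    · simp only [Nat.add_sub_cancel' h', add_sub_cancel_right]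
      rw [Finsupp.smul_single, smul_eq_mul, inv_mul_cancel₀ (pow_ne_zero _ (rate_ne_zero _))]
    · simp

theorem toCoord_fromCoord (y : ℕ × ℕ →₀ ℂ) : D.toCoord (D.fromCoord y) = y := by
  induction y using Finsupp.induction_linear with
  | zero => simp
  | add f g hf hg => simp only [map_add, hf, hg]
  | single i c =>
    rw [fromCoord_single, map_smul, toCoord_basisVec, Finsupp.smul_single, smul_eq_mul, mul_one]

/-- The change of basis is triangular in the generator index, since `C n` involves only earlier
generators; hence the strong induction. -/
theorem fromCoord_coordVec (i : ℕ × ℕ) :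
    D.fromCoord (D.coordVec i) = Finsupp.single i 1 := by
  obtain ⟨n, p⟩ := i
  induction n using Nat.strong_induction_on generalizing p with
  | _ n ih =>
    rcases lt_or_ge p (D.b n) with h | h
    · rw [D.coordVec_of_lt h, fromCoord_single, basisVec, if_pos h, smul_smul,
        mul_inv_cancel₀ (pow_ne_zero _ (rate_ne_zero _)), one_smul]
    · have hC : D.fromCoord (D.toCoord (shift (p - D.b n) (D.C n))) =
          shift (p - D.b n) (D.C n) := by
        have h₁ := map_shift_eq_sum (D.fromCoord ∘ₗ D.toCoord) (p - D.b n) (D.C n)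
        have h₂ := map_shift_eq_sum (LinearMap.id (R := ℂ) (M := ℕ × ℕ →₀ ℂ)) (p - D.b n) (D.C n)
        rw [LinearMap.comp_apply] at h₁
        rw [LinearMap.id_apply] at h₂
        rw [h₁]
        refine Eq.trans (Finset.sum_congr rfl fun j hj => ?_) h₂.symm
        beta_reduce
        rw [LinearMap.comp_apply, toCoord_single, one_smul, ih _ (D.fst_lt n j hj),
          LinearMap.id_apply]
      rw [D.coordVec_of_le h, map_add, hC, fromCoord_single, basisVec, if_neg (not_lt.2 h),
        smul_smul, mul_inv_cancel₀ (pow_ne_zero _ (rate_ne_zero _)), one_smul, rel, map_sub,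
        shift_single]
      simp [Nat.add_sub_cancel' h]

theorem fromCoord_toCoord (y : ℕ × ℕ →₀ ℂ) : D.fromCoord (D.toCoord y) = y := by
  induction y using Finsupp.induction_linear with
  | zero => simp
  | add f g hf hg => simp only [map_add, hf, hg]
  | single i c =>
    rw [toCoord_single, map_smul, fromCoord_coordVec, Finsupp.smul_single, smul_eq_mul, mul_one]

theorem formCoeff_comm (n l p : ℕ) : D.formCoeff n l p = D.formCoeff l n p := by
  rw [formCoeff, formCoeff, max_comm, min_comm]

theorem formCoeff_zero (p : ℕ) : D.formCoeff 0 0 p = if p = 0 then 1 else 0 := by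
  rw [formCoeff]
  simp

theorem formCoeff_of_lt {n l p : ℕ} (hn : n ≠ 0) (hl : l ≤ n) (hp : p < D.b n) :
    D.formCoeff n l p = 0 := by
  rw [formCoeff, max_eq_left hl, if_neg hn, if_pos hp]

theorem formCoeff_of_le {n l p : ℕ} (hn : n ≠ 0) (hl : l ≤ n) (hp : D.b n ≤ p) :
    D.formCoeff n l p = ∑ j ∈ (D.C n).support,
      D.C n j * D.formCoeff j.1 l (j.2 + (p - D.b n)) := by
  rw [formCoeff, max_eq_left hl, min_eq_right hl, if_neg hn, if_neg hp.not_gt]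
  exact Finset.sum_congr rfl fun j hj => dif_pos (D.fst_lt n j hj)

theorem form_comm (y z : ℕ × ℕ →₀ ℂ) : D.form y z = D.form z y := by
  induction y using Finsupp.induction_linear with
  | zero => simp
  | add f g hf hg => simp only [map_add, LinearMap.add_apply, hf, hg]
  | single i c =>
    induction z using Finsupp.induction_linear with
    | zero => simp
    | add f g hf hg => simp only [map_add, LinearMap.add_apply, hf, hg]
    | single j e =>
      rw [form_single, form_single, formCoeff_comm, add_comm i.2]
      ring

/-- The form depends on the two powers of X only through their sum. -/
theorem form_shift (u : ℕ) (y z : ℕ × ℕ →₀ ℂ) : D.form (shift u y) z = D.form y (shift u z) := by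
  induction y using Finsupp.induction_linear with
  | zero => simp
  | add f g hf hg => simp only [map_add, LinearMap.add_apply, hf, hg]
  | single i c =>
    induction z using Finsupp.induction_linear with
    | zero => simp
    | add f g hf hg => simp only [map_add, hf, hg]
    | single j e => simp only [shift_single, form_single, add_assoc, add_comm u]

/-- The relation vector of `gₙ` is orthogonal to the generators up to `gₙ`. -/
theorem form_rel_single {n : ℕ} (hn : n ≠ 0) (u : ℕ) {i : ℕ × ℕ} (hi : i.1 ≤ n) :
    D.form (shift u (D.rel n)) (Finsupp.single i 1) = 0 := by
  have h := map_shift_eq_sum (D.form.flip (Finsupp.single i 1)) u (D.C n)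
  simp only [LinearMap.flip_apply] at h
  rw [rel, map_sub, map_sub, LinearMap.sub_apply, shift_single, form_single, h,
    D.formCoeff_of_le hn hi (by simp only; omega), Finsupp.sum, sub_eq_zero, one_mul, one_mul]
  refine Finset.sum_congr rfl fun j _ => ?_
  rw [form_single, smul_eq_mul, one_mul, one_mul]
  congr 2
  simp only
  omega

theorem form_rel {n : ℕ} (hn : n ≠ 0) (u : ℕ) {z : ℕ × ℕ →₀ ℂ}
    (hz : ∀ i ∈ z.support, i.1 ≤ n) : D.form (shift u (D.rel n)) z = 0 := by
  rw [← Finsupp.sum_single z, Finsupp.sum, map_sum]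
  refine Finset.sum_eq_zero fun i hi => ?_
  rw [← mul_one (z i), ← smul_eq_mul, ← Finsupp.smul_single, map_smul,
    D.form_rel_single hn u (hz i hi), smul_zero]

end Tower

theorem map_eq_zero_of_single {Y : Type*} [NormedAddCommGroup Y] [NormedSpace ℂ Y]
    (f : (ℕ × ℕ →₀ ℂ) →ₗ[ℂ] Y) (y : ℕ × ℕ →₀ ℂ)
    (h : ∀ i ∈ y.support, f (Finsupp.single i 1) = 0) : f y = 0 := by
  have := norm_map_le_of_single f y (K := 0) fun i hi => by rw [h i hi, norm_zero]
  rwa [mul_zero, norm_le_zero_iff] at this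

theorem mem_support_shift {u : ℕ} {y : ℕ × ℕ →₀ ℂ} {i : ℕ × ℕ} (hi : i ∈ (shift u y).support) :
    ∃ j ∈ y.support, i = (j.1, j.2 + u) := by
  classical
  obtain ⟨j, hj, rfl⟩ := Finset.mem_image.1 (Finsupp.mapDomain_support hi)
  exact ⟨j, hj, rfl⟩

/-! ### Boundedness of the form and of multiplication by X -/

namespace Tower

variable (D : Tower)

theorem formBound_nonneg (n : ℕ) : 0 ≤ formBound D.A n :=
  zero_le_one.trans (one_le_formBound D.one_le_A n)

theorem A_nonneg (n : ℕ) : 0 ≤ D.A n := zero_le_one.trans (D.one_le_A n)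

theorem norm_formCoeff_le_mul {n l : ℕ} (hn : n ≠ 0) (hl : l ≤ n) {K : ℝ} (hK : 0 ≤ K)
    (h : ∀ k < n, ∀ q, ‖D.formCoeff k l q‖ ≤ K) (p : ℕ) :
    ‖D.formCoeff n l p‖ ≤ D.A n * K := by
  rcases lt_or_ge p (D.b n) with hp | hp
  · rw [D.formCoeff_of_lt hn hl hp, norm_zero]
    exact mul_nonneg (D.A_nonneg n) hK
  · rw [D.formCoeff_of_le hn hl hp]
    calc _ ≤ ∑ j ∈ (D.C n).support, ‖D.C n j‖ * K := by
          refine (norm_sum_le _ _).trans (Finset.sum_le_sum fun j hj => ?_)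
          rw [norm_mul]
          exact mul_le_mul_of_nonneg_left (h _ (D.fst_lt n j hj) _) (norm_nonneg _)
      _ ≤ _ := by
          rw [← Finset.sum_mul]
          exact mul_le_mul_of_nonneg_right (D.sum_norm_le n) hK

/-- Raising one index to n + 1 costs a factor `A (n + 1)`; the diagonal pair costs two, whence the
square in `formBound`. The exponents `b` do not enter, so they can be chosen afterwards. -/
theorem norm_formCoeff_le {n l k : ℕ} (hl : l ≤ n) (hk : k ≤ n) (p : ℕ) :
    ‖D.formCoeff l k p‖ ≤ formBound D.A n := by
  induction n generalizing l k p with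
  | zero =>
    obtain rfl : l = 0 := by omega
    obtain rfl : k = 0 := by omega
    rw [formCoeff_zero, formBound]
    split_ifs <;> simp
  | succ n ih =>
    have hA := D.one_le_A (n + 1)
    have hF := D.formBound_nonneg n
    have h₁ : ∀ m ≤ n, ∀ q, ‖D.formCoeff (n + 1) m q‖ ≤ D.A (n + 1) * formBound D.A n :=
      fun m hm q => D.norm_formCoeff_le_mul n.succ_ne_zero (by omega) hF
        (fun k hk q => ih (by omega) hm q) q
    have h₂ : ∀ q, ‖D.formCoeff (n + 1) (n + 1) q‖ ≤
        D.A (n + 1) * (D.A (n + 1) * formBound D.A n) := fun q =>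
      D.norm_formCoeff_le_mul n.succ_ne_zero le_rfl (mul_nonneg (D.A_nonneg _) hF)
        (fun k hk q => by rw [formCoeff_comm]; exact h₁ k (by omega) q) q
    have h₃ : D.A (n + 1) * formBound D.A n ≤ formBound D.A n * D.A (n + 1) ^ 2 := by
      have : D.A (n + 1) ≤ D.A (n + 1) ^ 2 := le_self_pow₀ hA two_ne_zero
      nlinarith
    have h₀ : formBound D.A n ≤ formBound D.A n * D.A (n + 1) ^ 2 :=
      le_mul_of_one_le_right hF (one_le_pow₀ hA)
    rw [formBound]
    rcases hl.lt_or_eq with hl | rfl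
    · rcases hk.lt_or_eq with hk | rfl
      · exact (ih (by omega) (by omega) p).trans h₀
      · rw [formCoeff_comm]
        exact (h₁ l (by omega) p).trans h₃
    · rcases hk.lt_or_eq with hk | rfl
      · exact (h₁ k (by omega) p).trans h₃
      · exact (h₂ p).trans (le_of_eq (by ring))

theorem mem_support_rel {n : ℕ} {i : ℕ × ℕ} (hi : i ∈ (D.rel n).support) :
    i = (n, D.b n) ∨ i ∈ (D.C n).support := by
  classical
  have := Finsupp.support_sub hi
  rw [Finset.mem_union] at this
  exact this.imp_left fun h => Finset.mem_singleton.1 (Finsupp.support_single_subset h)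

theorem fst_le_of_mem_support_rel {n : ℕ} {i : ℕ × ℕ} (hi : i ∈ (D.rel n).support) :
    i.1 ≤ n := by
  rcases D.mem_support_rel hi with rfl | h
  · exact le_rfl
  · exact (D.fst_lt n i h).le

theorem fst_le_of_mem_support_basisVec {i j : ℕ × ℕ} (hj : j ∈ (D.basisVec i).support) :
    j.1 ≤ i.1 := by
  unfold basisVec at hj
  split_ifs at hj with h
  · have := Finsupp.support_single_subset (Finsupp.support_smul hj)
    rw [Finset.mem_singleton.1 this]
  · obtain ⟨k, hk, rfl⟩ := mem_support_shift (Finsupp.support_smul hj)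
    exact D.fst_le_of_mem_support_rel (i := k) hk

theorem norm_form_single_shift_rel_le {n l : ℕ} (hl : l < n) (w : ℕ) :
    ‖D.form (Finsupp.single (n, 0) 1) (shift w (D.rel l))‖ ≤ 2 * D.A l * formBound D.A n := by
  have h : ∀ i : ℕ × ℕ, i.1 ≤ n →
      ‖(D.form (Finsupp.single (n, 0) 1) ∘ₗ shift w) (Finsupp.single i 1)‖ ≤
        formBound D.A n := by
    intro i hi
    rw [LinearMap.comp_apply, shift_single, form_single, one_mul, one_mul]
    exact D.norm_formCoeff_le le_rfl hi _
  have h₁ := h (l, D.b l) hl.le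
  have h₂ := norm_map_le_of_single (D.form (Finsupp.single (n, 0) 1) ∘ₗ shift w) (D.C l)
    fun i hi => h i ((D.fst_lt l i hi).le.trans hl.le)
  have h₃ := mul_le_mul_of_nonneg_right (D.sum_norm_le l) (D.formBound_nonneg n)
  have h₄ := mul_le_mul_of_nonneg_right (D.one_le_A l) (D.formBound_nonneg n)
  rw [← LinearMap.comp_apply, rel, map_sub]
  refine (norm_sub_le _ _).trans ?_
  linarith

/-- All monomials of the shifted relation vector have degree at most w + b l + d l, below the
threshold b n under which the form against gₙ vanishes. -/
theorem form_single_shift_rel_of_lt {n l w : ℕ} (hl : l < n) (hw : w + D.b l + D.d l < D.b n) :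
    D.form (Finsupp.single (n, 0) 1) (shift w (D.rel l)) = 0 := by
  rw [← LinearMap.comp_apply]
  refine map_eq_zero_of_single _ _ fun i hi => ?_
  rw [LinearMap.comp_apply, shift_single, form_single, D.formCoeff_of_lt (by omega)
    ((D.fst_le_of_mem_support_rel hi).trans hl.le), mul_zero, mul_zero]
  rcases D.mem_support_rel hi with rfl | h
  · simp only
    omega
  · have := D.snd_le l i h
    simp only
    omega

theorem norm_inv_rate_pow (n p : ℕ) : ‖((rate n : ℂ) ^ p)⁻¹‖ = (rate n ^ p)⁻¹ := by
  rw [norm_inv, norm_pow, norm_rate]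

theorem rate_pow_mono {l n p : ℕ} (h : l ≤ n) : rate l ^ p ≤ rate n ^ p :=
  pow_le_pow_left₀ (rate_pos l).le (rate_strictMono.monotone h) p

/-- If the vector of larger index n ≥ 1, or either one when the indices agree, is a shifted relation
vector, the form is 0 by orthogonality. Otherwise, for n ≥ 1, it vanishes in low total degree, and
in high degree `form_le` shows that the normalizing weights dominate the coefficient. For n = 0 the
coefficient is at most 1. -/
theorem norm_form_basisVec_le_of_le {i j : ℕ × ℕ} (h : j.1 ≤ i.1) :
    ‖D.form (D.basisVec i) (D.basisVec j)‖ ≤ 1 := by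
  obtain ⟨n, p⟩ := i
  obtain ⟨l, q⟩ := j
  simp only at h
  rcases lt_or_ge p (D.b n) with hp | hp
  · have hn : n ≠ 0 := by
      rintro rfl
      rw [D.b_zero] at hp
      omega
    have h0n : 0 < n := Nat.pos_of_ne_zero hn
    rcases lt_or_ge q (D.b l) with hq | hq
    · simp only [basisVec, hp, hq, if_true, map_smul, LinearMap.smul_apply, form_single,
        smul_eq_mul, one_mul]
      rcases lt_or_ge (p + q) (D.b n) with hpq | hpq
      · rw [D.formCoeff_of_lt hn h hpq]
        simp
      · have h₁ := D.norm_formCoeff_le le_rfl h (p + q)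
        have h₂ := D.form_le n 0 h0n
        rw [D.b_zero] at h₂
        have h₃ : rate 0 ^ (D.b n - 0 - D.d 0) ≤ rate 0 ^ (p + q) :=
          pow_le_pow_right₀ (one_lt_rate 0).le (by omega)
        have h₄ : rate 0 ^ (p + q) ≤ rate n ^ p * rate l ^ q := by
          rw [pow_add]
          exact mul_le_mul (rate_pow_mono (Nat.zero_le _)) (rate_pow_mono (Nat.zero_le _))
            (pow_pos (rate_pos _) _).le (pow_pos (rate_pos _) _).le
        have h₅ : formBound D.A n ≤ 2 * D.A 0 * formBound D.A n := by
          have := D.one_le_A 0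
          have := D.formBound_nonneg n
          nlinarith
        rw [norm_mul, norm_mul, norm_inv_rate_pow, norm_inv_rate_pow, ← mul_assoc, ← mul_inv,
          inv_mul_le_iff₀ (mul_pos (pow_pos (rate_pos _) _) (pow_pos (rate_pos _) _)), mul_one,
          mul_comm (rate l ^ q)]
        linarith
    · rcases h.lt_or_eq with hl | rfl
      · have hs : Finsupp.single (n, p) (1 : ℂ) = shift p (Finsupp.single (n, 0) 1) := by
          rw [shift_single, zero_add]
        simp only [basisVec, hp, not_lt.2 hq, if_true, if_false, map_smul, LinearMap.smul_apply,
          smul_eq_mul]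
        rw [hs, form_shift, shift_shift]
        set w := q - D.b l + p with hw
        rcases lt_or_ge (w + D.b l + D.d l) (D.b n) with hlt | hge
        · rw [D.form_single_shift_rel_of_lt hl hlt]
          simp
        · have h₁ := D.norm_form_single_shift_rel_le hl w
          have h₂ := D.form_le n l hl
          have h₃ : rate 0 ^ (D.b n - D.b l - D.d l) ≤ rate 0 ^ w :=
            pow_le_pow_right₀ (one_lt_rate 0).le (by omega)
          have h₄ : rate 0 ^ w ≤ rate l ^ (q - D.b l) * rate n ^ p := by
            rw [hw, pow_add]
            exact mul_le_mul (rate_pow_mono (Nat.zero_le _)) (rate_pow_mono (Nat.zero_le _))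
              (pow_pos (rate_pos _) _).le (pow_pos (rate_pos _) _).le
          rw [norm_mul, norm_mul, norm_inv_rate_pow, norm_inv_rate_pow, ← mul_assoc, ← mul_inv,
            inv_mul_le_iff₀ (mul_pos (pow_pos (rate_pos _) _) (pow_pos (rate_pos _) _)), mul_one]
          linarith
      · rw [form_comm]
        conv_lhs =>
          enter [1, 1, 2]
          rw [basisVec]
        simp only [not_lt.2 hq, if_false, map_smul, LinearMap.smul_apply]
        rw [D.form_rel hn _ fun i hi => D.fst_le_of_mem_support_basisVec hi]
        simp
  · rcases eq_or_ne n 0 with rfl | hn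
    · obtain rfl : l = 0 := by omega
      have hC : D.C 0 = 0 := by
        rw [← Finsupp.support_eq_empty, Finset.eq_empty_iff_forall_notMem]
        exact fun i hi => absurd (D.fst_lt 0 i hi) (by omega)
      have h₁ := D.norm_formCoeff_le (le_refl 0) le_rfl (p + q)
      simp only [basisVec, D.b_zero, rel, hC, not_lt.2 (Nat.zero_le _), if_false, sub_zero,
        shift_single, zero_add, map_smul, LinearMap.smul_apply, form_single, Nat.sub_zero,
        smul_eq_mul, one_mul]
      rw [norm_mul, norm_mul, norm_inv_rate_pow, norm_inv_rate_pow, ← mul_assoc]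
      refine mul_le_one₀ (mul_le_one₀ (inv_le_one_of_one_le₀ (one_le_rate_pow _ _))
        (inv_nonneg.2 (pow_pos (rate_pos _) _).le) (inv_le_one_of_one_le₀ (one_le_rate_pow _ _)))
        (norm_nonneg _) h₁
    · conv_lhs =>
        enter [1, 1, 2]
        rw [basisVec]
      simp only [not_lt.2 hp, if_false, map_smul, LinearMap.smul_apply]
      rw [D.form_rel hn _ fun i hi => (D.fst_le_of_mem_support_basisVec hi).trans h]
      simp

theorem norm_form_basisVec_le (i j : ℕ × ℕ) :
    ‖D.form (D.basisVec i) (D.basisVec j)‖ ≤ 1 := by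
  rcases le_total j.1 i.1 with h | h
  · exact D.norm_form_basisVec_le_of_le h
  · rw [form_comm]
    exact D.norm_form_basisVec_le_of_le h

theorem growthBound_nonneg (n : ℕ) : 0 ≤ growthBound D.A D.d n :=
  zero_le_one.trans (one_le_growthBound D.one_le_A n)

/-- The isometric image in `ℓ¹` of an element of the module. -/
noncomputable def toSpace : (ℕ × ℕ →₀ ℂ) →ₗ[ℂ] lp (fun _ : ℕ => ℂ) 1 :=
  toEllOne ∘ₗ D.toCoord

theorem toSpace_basisVec (i : ℕ × ℕ) :
    D.toSpace (D.basisVec i) = lp.single 1 (Nat.pair i.1 i.2) (1 : ℂ) := by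
  rw [toSpace, LinearMap.comp_apply, toCoord_basisVec, toEllOne_single, one_smul]

theorem norm_toSpace_shift_C_le {n : ℕ}
    (h : ∀ k ≤ n, ∀ p, ‖D.toSpace (Finsupp.single (k, p) 1)‖ ≤
      growthBound D.A D.d k * rate k ^ p) (u : ℕ) :
    ‖D.toSpace (shift u (D.C (n + 1)))‖ ≤ D.A (n + 1) *
      (growthBound D.A D.d n * rate n ^ (D.b (n + 1) + D.d (n + 1) + u)) := by
  rw [← LinearMap.comp_apply]
  have hG := D.growthBound_nonneg n
  refine (norm_map_le_of_single _ _ fun i hi => ?_).trans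
    (mul_le_mul_of_nonneg_right (D.sum_norm_le (n + 1))
      (mul_nonneg hG (pow_pos (rate_pos _) _).le))
  have h₁ := D.fst_lt _ i hi
  have h₂ := D.snd_le _ i hi
  have h₃ : i.1 ≤ n := by omega
  rw [LinearMap.comp_apply, shift_single]
  refine (h i.1 h₃ _).trans (mul_le_mul (growthBound_mono D.one_le_A h₃) ?_
    (pow_pos (rate_pos _) _).le hG)
  exact (rate_pow_mono h₃).trans (pow_le_pow_right₀ (one_lt_rate n).le (by omega))

/-- For p ≥ bₙ, X^p gₙ splits into a multiple of a basis vector and X^(p - bₙ) Cₙ. The latter has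
degree at most p + dₙ in earlier generators; the excess dₙ costs 2^dₙ, and their smaller rates are
replaced by `rate n`. -/
theorem norm_toSpace_single_le (n p : ℕ) :
    ‖D.toSpace (Finsupp.single (n, p) 1)‖ ≤ growthBound D.A D.d n * rate n ^ p := by
  induction n using Nat.strong_induction_on generalizing p with
  | _ n ih =>
    have hG := one_le_growthBound (d := D.d) D.one_le_A n
    have hr := (pow_pos (rate_pos n) p).le
    rcases lt_or_ge p (D.b n) with h | h
    · rw [toSpace, LinearMap.comp_apply, toCoord_single, one_smul, D.coordVec_of_lt h,
        norm_toEllOne_single, norm_pow, norm_rate]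
      exact le_mul_of_one_le_left hr hG
    · have h₁ : ‖D.toSpace (Finsupp.single (n, p) 1)‖ ≤
          rate n ^ p + ‖D.toSpace (shift (p - D.b n) (D.C n))‖ := by
        rw [toSpace, LinearMap.comp_apply, toCoord_single, one_smul, D.coordVec_of_le h, map_add]
        refine (norm_add_le _ _).trans (add_le_add_left ?_ _)
        rw [norm_toEllOne_single, norm_pow, norm_rate]
        exact pow_le_pow_right₀ (one_lt_rate n).le (by simp)
      cases n with
      | zero =>
        have hC : D.C 0 = 0 := by
          rw [← Finsupp.support_eq_empty, Finset.eq_empty_iff_forall_notMem]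
          exact fun i hi => absurd (D.fst_lt 0 i hi) (by omega)
        rw [hC, map_zero, map_zero, norm_zero, add_zero] at h₁
        exact h₁.trans (le_mul_of_one_le_left hr hG)
      | succ n =>
        have h₂ := D.norm_toSpace_shift_C_le (n := n) (fun k hk p => ih k (by omega) p)
          (p - D.b (n + 1))
        have h₃ : rate n ^ (D.b (n + 1) + D.d (n + 1) + (p - D.b (n + 1))) ≤
            2 ^ D.d (n + 1) * rate (n + 1) ^ p := by
          have : D.b (n + 1) + D.d (n + 1) + (p - D.b (n + 1)) = D.d (n + 1) + p := by omega
          rw [this, pow_add]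
          exact mul_le_mul (pow_le_pow_left₀ (rate_pos n).le (rate_le_two n) _)
            (rate_pow_mono n.le_succ) (pow_pos (rate_pos _) _).le (by positivity)
        have h₄ := mul_le_mul_of_nonneg_left (mul_le_mul_of_nonneg_left h₃
          (D.growthBound_nonneg n)) (D.A_nonneg (n + 1))
        rw [growthBound]
        linarith

theorem norm_toSpace_shift_basisVec_le (i : ℕ × ℕ) :
    ‖D.toSpace (shift 1 (D.basisVec i))‖ ≤ 2 := by
  obtain ⟨n, p⟩ := i
  have hstep : shift 1 (D.basisVec (n, p)) = (rate n : ℂ) • D.basisVec (n, p + 1) →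
      ‖D.toSpace (shift 1 (D.basisVec (n, p)))‖ ≤ 2 := by
    intro h
    rw [h, map_smul, toSpace_basisVec, norm_smul, norm_single_one, norm_rate, mul_one]
    exact rate_le_two n
  have hinv : ∀ m : ℕ, ((rate n : ℂ) ^ m)⁻¹ = (rate n : ℂ) * ((rate n : ℂ) ^ (m + 1))⁻¹ := by
    intro m
    have := rate_ne_zero n
    rw [pow_succ]
    field_simp
  rcases lt_or_ge p (D.b n) with hp | hp
  · rcases lt_or_ge (p + 1) (D.b n) with hp' | hp'
    · refine hstep ?_
      simp only [basisVec, hp, hp', if_true]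
      rw [map_smul, shift_single, smul_smul, hinv p]
    -- The only step that is not a weighted shift: X^b • g is the relation vector plus C. The
    -- summand 1 in `growthBound` pays for the former, the other for C, and `growth_le` bounds the
    -- total by `rate (n + 1) ^ (p + 1)`.
    · have hb : D.b n = p + 1 := by omega
      have hn : n ≠ 0 := by
        rintro rfl
        rw [D.b_zero] at hp
        omega
      obtain ⟨n, rfl⟩ := Nat.exists_eq_succ_of_ne_zero hn
      rw [Nat.succ_eq_add_one] at *
      have h₁ : shift 1 (D.basisVec (n + 1, p)) =
          ((rate (n + 1) : ℂ) ^ p)⁻¹ • (D.basisVec (n + 1, p + 1) + D.C (n + 1)) := by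
        have : D.basisVec (n + 1, p + 1) = D.rel (n + 1) := by
          rw [basisVec, if_neg (by simp only; omega)]
          simp [hb, shift_zero]
        rw [this, rel, hb, sub_add_cancel]
        simp only [basisVec, hp, if_true]
        rw [map_smul, shift_single]
      have h₂ := D.norm_toSpace_shift_C_le (fun k _ p => D.norm_toSpace_single_le k p) (n := n) 0
      rw [shift_zero, add_zero, hb] at h₂
      have h₃ := D.growth_le n
      rw [hb, growthBound] at h₃
      have h₄ : rate n ^ (p + 1 + D.d (n + 1)) ≤ 2 ^ D.d (n + 1) * rate n ^ (p + 1) := by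
        rw [add_comm, pow_add]
        exact mul_le_mul_of_nonneg_right (pow_le_pow_left₀ (rate_pos n).le (rate_le_two n) _)
          (pow_pos (rate_pos _) _).le
      have h₅ := mul_le_mul_of_nonneg_left (mul_le_mul_of_nonneg_left h₄
        (D.growthBound_nonneg n)) (D.A_nonneg (n + 1))
      have h₆ := one_le_rate_pow n (p + 1)
      have h₇ := mul_le_mul_of_nonneg_left (rate_le_two (n + 1))
        (pow_pos (rate_pos (n + 1)) p).le
      have h₈ : ‖D.toSpace (D.basisVec (n + 1, p + 1) + D.C (n + 1))‖ ≤
          1 + ‖D.toSpace (D.C (n + 1))‖ := by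
        rw [map_add, toSpace_basisVec]
        refine (norm_add_le _ _).trans ?_
        rw [norm_single_one]
      rw [h₁, map_smul, norm_smul, norm_inv_rate_pow,
        inv_mul_le_iff₀ (pow_pos (rate_pos _) _)]
      rw [pow_succ (rate (n + 1))] at h₃
      linarith
  · refine hstep ?_
    have hp' : ¬ p + 1 < D.b n := by omega
    simp only [basisVec, not_lt.2 hp, hp', if_false]
    have hs : p + 1 - D.b n = p - D.b n + 1 := by omega
    rw [map_smul, shift_shift, smul_smul, hs, hinv]

end Tower

/-! ### Passage to ℓ¹ -/

namespace Tower

variable (D : Tower)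

theorem toSpace_fromCoord (z : ℕ × ℕ →₀ ℂ) : D.toSpace (D.fromCoord z) = toEllOne z := by
  rw [toSpace, LinearMap.comp_apply, toCoord_fromCoord]

theorem denseRange_toSpace : DenseRange D.toSpace := by
  refine denseRange_toEllOne.mono ?_
  rintro _ ⟨z, rfl⟩
  exact ⟨D.fromCoord z, D.toSpace_fromCoord z⟩

theorem exists_operator : ∃ T : lp (fun _ : ℕ => ℂ) 1 →L[ℂ] lp (fun _ : ℕ => ℂ) 1,
    ∀ y, T (D.toSpace y) = D.toSpace (shift 1 y) := by
  obtain ⟨T, hT, -⟩ := exists_clm_single_eq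
    (fun k => D.toSpace (shift 1 (D.basisVec (Nat.unpair k))))
    (fun k => D.norm_toSpace_shift_basisVec_le _)
  refine ⟨T, fun y => ?_⟩
  rw [← D.fromCoord_toCoord y]
  induction D.toCoord y using Finsupp.induction_linear with
  | zero => simp
  | add f g hf hg => simp only [map_add, hf, hg]
  | single i c =>
    rw [toSpace_fromCoord, toEllOne_single, map_smul, hT, Nat.unpair_pair, fromCoord_single,
      map_smul, map_smul]

/-- On ℓ¹ bounded matrix entries suffice: each row gives a functional of norm at most 1, and the
rows define an operator into the dual. -/
theorem exists_form :
    ∃ B : lp (fun _ : ℕ => ℂ) 1 →L[ℂ] lp (fun _ : ℕ => ℂ) 1 →L[ℂ] ℂ,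
      ∀ y z, B (D.toSpace y) (D.toSpace z) = D.form y z := by
  have h : ∀ k : ℕ, ∃ L : lp (fun _ : ℕ => ℂ) 1 →L[ℂ] ℂ,
      (∀ l, L (lp.single 1 l 1) =
        D.form (D.basisVec (Nat.unpair k)) (D.basisVec (Nat.unpair l))) ∧ ‖L‖ ≤ 1 := fun k =>
    exists_clm_single_eq _ fun l => D.norm_form_basisVec_le _ _
  choose β hβ hβn using h
  obtain ⟨B, hB, -⟩ := exists_clm_single_eq β hβn
  refine ⟨B, fun y z => ?_⟩
  rw [← D.fromCoord_toCoord y, ← D.fromCoord_toCoord z]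
  induction D.toCoord y using Finsupp.induction_linear with
  | zero => simp
  | add f g hf hg => simp only [map_add, add_apply, LinearMap.add_apply, hf, hg]
  | single i c =>
    induction D.toCoord z using Finsupp.induction_linear with
    | zero => simp
    | add f g hf hg => simp only [map_add, hf, hg]
    | single j e =>
      rw [toSpace_fromCoord, toSpace_fromCoord, toEllOne_single, toEllOne_single, map_smul,
        map_smul B, hB, smul_apply, hβ, Nat.unpair_pair, Nat.unpair_pair, fromCoord_single,
        fromCoord_single, map_smul, map_smul, LinearMap.smul_apply]

theorem exists_operator_form : ∃ T : lp (fun _ : ℕ => ℂ) 1 →L[ℂ] lp (fun _ : ℕ => ℂ) 1,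
    ∃ B : lp (fun _ : ℕ => ℂ) 1 →L[ℂ] lp (fun _ : ℕ => ℂ) 1 →L[ℂ] ℂ,
      (∀ y, T (D.toSpace y) = D.toSpace (shift 1 y)) ∧ (∀ x y, B (T x) y = B x (T y)) ∧
        B ≠ 0 := by
  obtain ⟨T, hT⟩ := D.exists_operator
  obtain ⟨B, hB⟩ := D.exists_form
  refine ⟨T, B, hT, fun x y => ?_, ?_⟩
  · refine D.denseRange_toSpace.induction_on₂ (p := fun x y => B (T x) y = B x (T y))
      (isClosed_eq (by fun_prop) (by fun_prop)) (fun y z => ?_) x y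
    rw [hT, hT, hB, hB, form_shift]
  · rintro rfl
    have := hB (Finsupp.single (0, 0) 1) (Finsupp.single (0, 0) 1)
    rw [form_single, formCoeff_zero] at this
    simp at this

theorem operator_pow_toSpace {T : lp (fun _ : ℕ => ℂ) 1 →L[ℂ] lp (fun _ : ℕ => ℂ) 1}
    (hT : ∀ y, T (D.toSpace y) = D.toSpace (shift 1 y)) (m : ℕ) (y : ℕ × ℕ →₀ ℂ) :
    (T ^ m) (D.toSpace y) = D.toSpace (shift m y) := by
  induction m with
  | zero => simp [shift_zero]
  | succ m ih => rw [pow_succ', mul_apply_eq_comp, ih, hT, shift_shift]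

theorem b_pos {n : ℕ} (hn : 0 < n) : 0 < D.b n := by
  have := D.sep n 0 hn
  omega

/-- With `norm_toSpace_rel`, this makes both errors in the transitivity step equal to η. -/
theorem norm_toSpace_generator {n : ℕ} (hn : 0 < n) :
    ‖D.toSpace (Finsupp.single (n, 0) 1)‖ = 1 := by
  have : D.basisVec (n, 0) = Finsupp.single (n, 0) 1 := by
    simp [basisVec, D.b_pos hn]
  rw [← this, toSpace_basisVec, norm_single_one]

theorem norm_toSpace_rel (n : ℕ) : ‖D.toSpace (D.rel n)‖ = 1 := by
  have : D.basisVec (n, D.b n) = D.rel n := by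
    simp [basisVec, shift_zero]
  rw [← this, toSpace_basisVec, norm_single_one]

/-- The span of the canonical basis over a dense additive group of scalars is dense. -/
theorem denseRange_toSpace_mapRange {S : Type*} [AddCommGroup S] (θ : S →+ ℂ)
    (hθ : DenseRange θ) :
    DenseRange fun r : ℕ × ℕ →₀ S => D.toSpace (Finsupp.mapRange.addMonoidHom θ r) := by
  let g : (ℕ × ℕ →₀ S) →+ lp (fun _ : ℕ => ℂ) 1 :=
    D.toSpace.toAddMonoidHom.comp (Finsupp.mapRange.addMonoidHom θ)
  have h : ∀ y, D.toSpace y ∈ g.range.topologicalClosure := by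
    intro y
    induction y using Finsupp.induction_linear with
    | zero =>
      rw [map_zero]
      exact zero_mem _
    | add f g hf hg =>
      rw [map_add]
      exact add_mem hf hg
    | single i c =>
      have hc : Continuous fun c : ℂ => D.toSpace (Finsupp.single i c) := by
        have : (fun c : ℂ => D.toSpace (Finsupp.single i c)) =
            fun c => c • D.toSpace (Finsupp.single i 1) := by
          ext1 c
          rw [← map_smul]
          simp
        rw [this]
        fun_prop
      refine map_mem_closure (f := fun c : ℂ => D.toSpace (Finsupp.single i c)) hc (hθ c) ?_
      rintro _ ⟨a, rfl⟩
      exact ⟨Finsupp.single i a, by simp [g]⟩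
  intro x
  refine closure_minimal (s := Set.range D.toSpace) ?_ isClosed_closure (D.denseRange_toSpace x)
  rintro _ ⟨y, rfl⟩
  exact h y

end Tower

/-! ### Choice of the exponents -/

section Exponents

/-- The exponents `m, 2m, …, 2ˢm`, with `m = m s`, of the generators with indices from `2 ^ s` to
`2 ^ (s + 1) - 1` can be chosen with arbitrarily large gaps. -/
theorem exists_block_exponents (h : ℕ → ℕ) :
    ∃ b m : ℕ → ℕ, b 0 = 0 ∧ (∀ n, b n + h n ≤ b (n + 1)) ∧
      ∀ s, ∀ i < 2 ^ s, b (2 ^ s + i) = (i + 1) * m s := by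
  -- The term 2^s m s is the last exponent of block s; the sum dominates every gap required up to
  -- the end of block s + 1.
  let m : ℕ → ℕ := fun s => Nat.rec (∑ n ∈ Finset.range 2, h n)
    (fun s ms => 2 ^ s * ms + ∑ n ∈ Finset.range (2 ^ (s + 2)), h n) s
  have hm : ∀ s, ∀ n < 2 ^ (s + 1), h n ≤ m s := by
    intro s n hn
    have hsum : h n ≤ ∑ n ∈ Finset.range (2 ^ (s + 1)), h n :=
      Finset.single_le_sum (f := h) (fun _ _ => Nat.zero_le _) (Finset.mem_range.2 hn)
    cases s with
    | zero => exact hsum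
    | succ s => exact hsum.trans (Nat.le_add_left _ _)
  have hm' : ∀ s, ∀ n < 2 ^ (s + 2), 2 ^ s * m s + h n ≤ m (s + 1) := fun s n hn =>
    Nat.add_le_add_left (Finset.single_le_sum (f := h) (fun _ _ => Nat.zero_le _)
      (Finset.mem_range.2 hn)) _
  let b : ℕ → ℕ := fun n =>
    if n = 0 then 0 else (n - 2 ^ Nat.log 2 n + 1) * m (Nat.log 2 n)
  have hb : ∀ s, ∀ i < 2 ^ s, b (2 ^ s + i) = (i + 1) * m s := by
    intro s i hi
    have hlog : Nat.log 2 (2 ^ s + i) = s :=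
      Nat.log_eq_of_pow_le_of_lt_pow (by omega) (by rw [pow_succ]; omega)
    have h0 : 2 ^ s + i ≠ 0 := by positivity
    simp only [b, if_neg h0, hlog, Nat.add_sub_cancel_left]
  refine ⟨b, m, rfl, fun n => ?_, hb⟩
  rcases Nat.eq_zero_or_pos n with rfl | hn
  · have h1 := hb 0 0 (by simp)
    have h2 := hm 0 0 (by simp)
    have h3 : b 0 = 0 := rfl
    simp only [pow_zero, add_zero, zero_add, one_mul] at h1
    rw [zero_add, h1, h3]
    omega
  · obtain ⟨s, i, hi, rfl⟩ : ∃ s i, i < 2 ^ s ∧ n = 2 ^ s + i := by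
      refine ⟨Nat.log 2 n, n - 2 ^ Nat.log 2 n, ?_, ?_⟩
      · have := Nat.lt_pow_succ_log_self (b := 2) (by norm_num) n
        rw [pow_succ] at this
        omega
      · have := Nat.pow_log_le_self 2 hn.ne'
        omega
    rw [hb s i hi]
    have hlt : 2 ^ s + i < 2 ^ (s + 1) := by
      rw [pow_succ]
      omega
    rcases Nat.lt_or_ge (i + 1) (2 ^ s) with hi' | hi'
    · have := hm s _ hlt
      rw [add_assoc, hb s (i + 1) hi', add_mul (i + 1)]
      omega
    · have h1 : 2 ^ s + i + 1 = 2 ^ (s + 1) + 0 := by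
        rw [pow_succ]
        omega
      have h2 : i + 1 = 2 ^ s := by omega
      rw [h1, hb (s + 1) 0 (by positivity), h2, zero_add, one_mul]
      exact hm' s _ (hlt.trans (Nat.pow_lt_pow_right (by norm_num) (by omega)))

/-- Powers of `rate 0` and of `rate (n + 1) / rate n` tend to infinity. The threshold depends only
on `A` and `d`, never on the exponents. -/
theorem exists_gap_threshold {A : ℕ → ℝ} (d : ℕ → ℕ) (n : ℕ) :
    ∃ h : ℕ, ∀ β ≥ h, (∀ l < n + 1, d l < β ∧
      2 * A l * formBound A (n + 1) ≤ rate 0 ^ (β - d l)) ∧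
        growthBound A d (n + 1) * rate n ^ β ≤ rate (n + 1) ^ β := by
  have h₁ : ∀ l, ∀ᶠ β in atTop, d l < β ∧
      2 * A l * formBound A (n + 1) ≤ rate 0 ^ (β - d l) := fun l =>
    (eventually_gt_atTop (d l)).and <|
      ((tendsto_pow_atTop_atTop_of_one_lt (one_lt_rate 0)).comp
        (tendsto_sub_atTop_nat (d l))).eventually_ge_atTop _
  have h₂ : ∀ᶠ β in atTop, growthBound A d (n + 1) * rate n ^ β ≤ rate (n + 1) ^ β := by
    have hr : 1 < rate (n + 1) / rate n := by
      rw [one_lt_div (rate_pos n)]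
      exact rate_strictMono n.lt_succ_self
    filter_upwards [(tendsto_pow_atTop_atTop_of_one_lt hr).eventually_ge_atTop
      (growthBound A d (n + 1))] with β hβ
    rwa [div_pow, le_div_iff₀ (pow_pos (rate_pos n) β)] at hβ
  have h₃ : ∀ᶠ β in atTop, ∀ l ∈ Finset.range (n + 1), d l < β ∧
      2 * A l * formBound A (n + 1) ≤ rate 0 ^ (β - d l) :=
    (Filter.eventually_all_finset _).2 fun l _ => h₁ l
  obtain ⟨h, hh⟩ := eventually_atTop.1 (h₃.and h₂)
  exact ⟨h, fun β hβ => ⟨fun l hl => (hh β hβ).1 l (Finset.mem_range.2 hl), (hh β hβ).2⟩⟩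

end Exponents

/-! ### Towers with prescribed relations -/

section SumNorm

theorem sum_norm_support_eq {y : ℕ × ℕ →₀ ℂ} {s : Finset (ℕ × ℕ)} (h : y.support ⊆ s) :
    ∑ i ∈ y.support, ‖y i‖ = ∑ i ∈ s, ‖y i‖ :=
  Finset.sum_subset h fun i _ hi => by rw [Finsupp.notMem_support_iff.1 hi, norm_zero]

theorem sum_norm_support_sub_le (y z : ℕ × ℕ →₀ ℂ) :
    ∑ i ∈ (y - z).support, ‖(y - z) i‖ ≤
      ∑ i ∈ y.support, ‖y i‖ + ∑ i ∈ z.support, ‖z i‖ := by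
  classical
  rw [sum_norm_support_eq (Finsupp.support_sub (f := y) (g := z)),
    sum_norm_support_eq (Finset.subset_union_left : y.support ⊆ y.support ∪ z.support),
    sum_norm_support_eq (Finset.subset_union_right : z.support ⊆ y.support ∪ z.support),
    ← Finset.sum_add_distrib]
  exact Finset.sum_le_sum fun i _ => by
    rw [Finsupp.sub_apply]
    exact norm_sub_le _ _

theorem sum_norm_support_smul_le (c : ℂ) (y : ℕ × ℕ →₀ ℂ) :
    ∑ i ∈ (c • y).support, ‖(c • y) i‖ ≤ ‖c‖ * ∑ i ∈ y.support, ‖y i‖ := by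
  rw [sum_norm_support_eq Finsupp.support_smul, Finset.mul_sum]
  exact Finset.sum_le_sum fun i _ => by simp

theorem sum_norm_support_shift (u : ℕ) (y : ℕ × ℕ →₀ ℂ) :
    ∑ i ∈ (shift u y).support, ‖shift u y i‖ = ∑ i ∈ y.support, ‖y i‖ := by
  have hinj : Function.Injective fun i : ℕ × ℕ => (i.1, i.2 + u) := by
    rintro ⟨a, b⟩ ⟨c, d⟩ h
    simpa using h
  exact Finsupp.sum_mapDomain_index_inj (h := fun _ c => ‖c‖) hinj

end SumNorm

/-- For prescribed `Pₙ`, `Qₙ` in the span of the generators before `gₙ`, there is a tower with the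
relations `X ^ bₙ • (Pₙ + ηₙ gₙ) = Qₙ`, up to `ηₙ` times a basis vector. -/
theorem exists_tower (P Q : ℕ → (ℕ × ℕ →₀ ℂ)) (η : ℕ → ℝ)
    (hP : ∀ n, ∀ i ∈ (P n).support, i.1 < n) (hQ : ∀ n, ∀ i ∈ (Q n).support, i.1 < n) :
    ∃ (D : Tower) (m : ℕ → ℕ), (∀ n, D.C n = (η n : ℂ)⁻¹ • (Q n - shift (D.b n) (P n))) ∧
      ∀ s, ∀ i < 2 ^ s, D.b (2 ^ s + i) = (i + 1) * m s := by
  classical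
  -- Shifting P preserves its coefficient sum, so `A` and `d` can be fixed before `b` and the choice
  -- is not circular.
  let A : ℕ → ℝ := fun n => 1 + ‖(η n : ℂ)⁻¹‖ *
    (∑ i ∈ (Q n).support, ‖Q n i‖ + ∑ i ∈ (P n).support, ‖P n i‖)
  let d : ℕ → ℕ := fun n => ((P n).support ∪ (Q n).support).sup Prod.snd
  have hA : ∀ n, 1 ≤ A n := fun n => le_add_of_nonneg_right (by positivity)
  choose h hh using exists_gap_threshold (A := A) d
  obtain ⟨b, m, hb0, hb, hbm⟩ := exists_block_exponents h
  have hmono : Monotone b := monotone_nat_of_le_succ fun n => by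
    have := hb n
    omega
  have hgap : ∀ n, ∀ l < n + 1, h n ≤ b (n + 1) - b l := fun n l hl => by
    have h1 := hb n
    have h2 := hmono (Nat.lt_succ_iff.1 hl)
    omega
  have hsupp : ∀ n, ∀ i ∈ ((η n : ℂ)⁻¹ • (Q n - shift (b n) (P n))).support,
      i ∈ (Q n).support ∨ ∃ j ∈ (P n).support, i = (j.1, j.2 + b n) := by
    intro n i hi
    rcases Finset.mem_union.1 (Finsupp.support_sub (Finsupp.support_smul hi)) with hi | hi
    · exact Or.inl hi
    · exact Or.inr (mem_support_shift hi)
  refine ⟨{ b := b, C := fun n => (η n : ℂ)⁻¹ • (Q n - shift (b n) (P n)), A := A, d := d,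
            one_le_A := hA, b_zero := hb0, fst_lt := ?_, snd_le := ?_, sum_norm_le := ?_,
            sep := ?_, form_le := ?_, growth_le := ?_ }, m, fun n => rfl, hbm⟩
  · intro n i hi
    rcases hsupp n i hi with hi | ⟨j, hj, rfl⟩
    · exact hQ n i hi
    · exact hP n j hj
  · intro n i hi
    rcases hsupp n i hi with hi | ⟨j, hj, rfl⟩
    · have : i.2 ≤ d n := Finset.le_sup (f := Prod.snd) (Finset.mem_union_right _ hi)
      omega
    · have : j.2 ≤ d n := Finset.le_sup (f := Prod.snd) (Finset.mem_union_left _ hj)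
      simp only
      omega
  · intro n
    refine (sum_norm_support_smul_le _ _).trans ?_
    have h1 := sum_norm_support_sub_le (Q n) (shift (b n) (P n))
    rw [sum_norm_support_shift] at h1
    have h2 := mul_le_mul_of_nonneg_left h1 (norm_nonneg (η n : ℂ)⁻¹)
    simp only [A]
    linarith
  · intro n l hl
    cases n with
    | zero => omega
    | succ n =>
      have := ((hh n _ (hgap n l hl)).1 l hl).1
      omega
  · intro n l hl
    cases n with
    | zero => omega
    | succ n => exact ((hh n _ (hgap n l hl)).1 l hl).2
  · intro n
    exact (hh n _ (by have := hb n; omega)).2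

/-! ### Enumeration of tasks and conclusion -/

theorem denseRange_rat_complex :
    ∃ θ : ℚ × ℚ →+ ℂ, DenseRange θ := by
  let θ : ℚ × ℚ →+ ℂ :=
    { toFun := fun q => Complex.equivRealProdCLM.symm ((q.1 : ℝ), (q.2 : ℝ))
      map_zero' := by simp
      map_add' := fun p q => by
        rw [← map_add]
        simp }
  refine ⟨θ, ?_⟩
  have h : DenseRange (Prod.map ((↑) : ℚ → ℝ) ((↑) : ℚ → ℝ)) :=
    Rat.denseRange_cast.prodMap Rat.denseRange_cast
  exact Complex.equivRealProdCLM.symm.surjective.denseRange.comp h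
    Complex.equivRealProdCLM.symm.continuous

theorem exists_infinitely_often (τ : Type*) [Countable τ] [Nonempty τ] :
    ∃ f : ℕ → τ, ∀ t N, ∃ s ≥ N, f s = t := by
  obtain ⟨g, hg⟩ := exists_surjective_nat τ
  refine ⟨fun s => g (Nat.unpair s).1, fun t N => ?_⟩
  obtain ⟨a, rfl⟩ := hg t
  exact ⟨Nat.pair a N, Nat.right_le_pair a N, by simp⟩

theorem exists_fst_bound {n : ℕ} (y : Fin n → (ℕ × ℕ →₀ ℂ)) :
    ∃ N, ∀ i, ∀ j ∈ (y i).support, j.1 < N := by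
  refine ⟨(Finset.univ.sup fun i => (y i).support.sup Prod.fst) + 1, fun i j hj => ?_⟩
  have h₁ : j.1 ≤ (y i).support.sup Prod.fst := Finset.le_sup (f := Prod.fst) hj
  have h₂ : (y i).support.sup Prod.fst ≤ _ :=
    Finset.le_sup (f := fun i => (y i).support.sup Prod.fst) (Finset.mem_univ i)
  omega

theorem theorem4p3 :
    ∃ T : lp (fun _ : ℕ => ℂ) 1 →L[ℂ] lp (fun _ : ℕ => ℂ) 1,
      ¬ IsWeaklyMixing T ∧
      ¬ SatisfiesHypercyclicityCriterion T ∧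
      ∀ n : ℕ, 1 ≤ n → IsHypercyclic (directSumPowers T n) := by
  classical
  obtain ⟨θ, hθ⟩ := denseRange_rat_complex
  let R := ℕ × ℕ →₀ ℚ × ℚ
  let toM : R →+ (ℕ × ℕ →₀ ℂ) := Finsupp.mapRange.addMonoidHom θ
  obtain ⟨f, hf⟩ := exists_infinitely_often (List R × List R × ℕ)
  let task : ℕ → List R × List R × ℕ := fun ν => f (Nat.log 2 ν)
  let idx : ℕ → ℕ := fun ν => ν - 2 ^ Nat.log 2 ν
  -- All generators of block s work on the task f s, the i-th on the i-th list entries. The default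
  -- 0 covers short lists, and the filter enforces that only earlier generators occur.
  let P : ℕ → (ℕ × ℕ →₀ ℂ) := fun ν =>
    (toM ((task ν).1.getD (idx ν) 0)).filter fun i => i.1 < ν
  let Q : ℕ → (ℕ × ℕ →₀ ℂ) := fun ν =>
    (toM ((task ν).2.1.getD (idx ν) 0)).filter fun i => i.1 < ν
  let η : ℕ → ℝ := fun ν => 1 / (((task ν).2.2 : ℝ) + 1)
  have hfilter : ∀ (ν : ℕ) (y : ℕ × ℕ →₀ ℂ), ∀ i ∈ (y.filter fun i => i.1 < ν).support,
      i.1 < ν := fun ν y i hi => by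
    rw [Finsupp.support_filter, Finset.mem_filter] at hi
    exact hi.2
  obtain ⟨D, m, hC, hb⟩ := exists_tower P Q η (fun ν => hfilter ν _) (fun ν => hfilter ν _)
  obtain ⟨T, B, hT, hBT, hB⟩ := D.exists_operator_form
  refine ⟨T, not_isWeaklyMixing_of_form hBT hB,
    not_satisfiesHypercyclicityCriterion_of_form hBT hB, fun n _ => ?_⟩
  have hdense : DenseRange fun r : R => D.toSpace (toM r) := D.denseRange_toSpace_mapRange θ hθ
  have : TopologicalSpace.SeparableSpace (lp (fun _ : ℕ => ℂ) 1) :=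
    ⟨⟨_, Set.countable_range _, hdense⟩⟩
  have : SecondCountableTopology (lp (fun _ : ℕ => ℂ) 1) :=
    UniformSpace.secondCountable_of_separable _
  refine isHypercyclic_directSumPowers T n hdense fun x y hx hy ε hε => ?_
  choose p hp using hx
  choose q hq using hy
  obtain ⟨j, hj⟩ := exists_nat_one_div_lt hε
  obtain ⟨N₁, hN₁⟩ := exists_fst_bound fun i => toM (p i)
  obtain ⟨N₂, hN₂⟩ := exists_fst_bound fun i => toM (q i)
  -- A late occurrence of the task: its block has at least n generators, and the filters in P and Q
  -- change nothing there.
  obtain ⟨s, hs, hfs⟩ := hf (List.ofFn p, List.ofFn q, j) (max n (max N₁ N₂))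
  have hs2 : s < 2 ^ s := Nat.lt_two_pow_self
  have hlog : ∀ i : Fin n, Nat.log 2 (2 ^ s + i) = s := fun i =>
    Nat.log_eq_of_pow_le_of_lt_pow (by omega) (by rw [pow_succ]; omega)
  have hPp : ∀ i : Fin n, P (2 ^ s + i) = toM (p i) := fun i => by
    simp only [P, task, idx, hlog, hfs, Nat.add_sub_cancel_left]
    rw [List.getD_eq_getElem _ _ (by simp), List.getElem_ofFn, Finsupp.filter_eq_self_iff]
    intro k hk
    have := hN₁ i k (Finsupp.mem_support_iff.2 hk)
    omega
  have hQq : ∀ i : Fin n, Q (2 ^ s + i) = toM (q i) := fun i => by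
    simp only [Q, task, idx, hlog, hfs, Nat.add_sub_cancel_left]
    rw [List.getD_eq_getElem _ _ (by simp), List.getElem_ofFn, Finsupp.filter_eq_self_iff]
    intro k hk
    have := hN₂ i k (Finsupp.mem_support_iff.2 hk)
    omega
  have hηj : ∀ i : Fin n, η (2 ^ s + i) = 1 / ((j : ℝ) + 1) := fun i => by
    simp only [η, task, hlog, hfs]
  set δ : ℝ := 1 / ((j : ℝ) + 1) with hδ
  have hδ0 : 0 < δ := by positivity
  have hδn : ‖(δ : ℂ)‖ = δ := by rw [Complex.norm_real, Real.norm_of_nonneg hδ0.le]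
  -- The i-th coordinate is perturbed by δ times its own generator, whose exponent is (i + 1) m s.
  refine ⟨m s, fun i => D.toSpace (toM (p i) + (δ : ℂ) • Finsupp.single (2 ^ s + (i : ℕ), 0) 1),
    fun i => ⟨?_, ?_⟩⟩
  · rw [← hp i]
    beta_reduce
    rw [map_add, add_sub_cancel_left, map_smul, norm_smul,
      D.norm_toSpace_generator (by positivity), hδn, mul_one]
    exact hj
  · have hbi := hb s i (by omega)
    have key : shift (D.b (2 ^ s + i)) (toM (p i) +
        (δ : ℂ) • Finsupp.single (2 ^ s + (i : ℕ), 0) 1) =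
        toM (q i) + (δ : ℂ) • D.rel (2 ^ s + i) := by
      have hδ' : (δ : ℂ) ≠ 0 := by exact_mod_cast hδ0.ne'
      rw [Tower.rel, hC, hηj, hPp, hQq, map_add, map_smul, shift_single, smul_sub, smul_smul,
        mul_inv_cancel₀ hδ', one_smul]
      simp only [zero_add]
      abel
    rw [D.operator_pow_toSpace hT, ← hbi, key, ← hq i]
    beta_reduce
    rw [map_add, add_sub_cancel_left, map_smul,
      norm_smul, D.norm_toSpace_rel, hδn, mul_one]
    exact hj
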